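/- Let $A$ be a complex $n\times n$ matrix whose largest singular value satisfies $\|A\|_\infty\le 1$ and whose spectrum $\sigma(A)$ lies in the open unit disk $\mathbb D$. Let $m(z)=\prod_{i=1}^{|m|}(z-\lambda_i)$ be its minimal polynomial (zeros listed with multiplicity, in any order) and $B(z)=\prod_{i=1}^{|m|}\frac{z-\lambda_i}{1-\bar\lambda_i z}$ the associated Blaschke product. Let $H_2$ be the Hardy space, regarded as the closed subspace of $L^2(\partial\mathbb D,\frac{|dz|}{2\pi})$ of functions whose negative Fourier coefficients vanish, let $K_B=H_2\ominus BH_2$ be the model space, and let $M_B:K_B\to K_B$, $M_Bf=P_B(zf)$, be the compressed shift, where $P_B$ is the orthogonal projection onto $K_B$. Write $\|\cdot\|_\infty$ for the operator norm (the largest singular value). Then: 1. For every $\zeta\in\mathbb C\setminus\sigma(A)$ the operator $\zeta-M_B$ is invertible and $$\|(\zeta-A)^{-1}\|_\infty\le\|(\zeta-M_B)^{-1}\|_\infty .$$ 2. The Malmquist–Walsh functions $$e_k(z)=\frac{(1-|\lambda_k|^2)^{1/2}}{1-\bar\lambda_k z}\prod_{i=1}^{k-1}\frac{z-\lambda_i}{1-\bar\lambda_i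 z},\qquad k=1,\dots,|m|,$$ form an orthonormal basis of $K_B$, and with respect to this basis, for every $\zeta\in\mathbb C\setminus\sigma(A)$, $$\left((\zeta-M_B)^{-1}\right)_{ij}=\begin{cases}0 & \text{if } i<j,\\ \dfrac{1}{\zeta-\lambda_i} & \text{if } i=j,\\ \dfrac{(1-|\lambda_i|^2)^{1/2}}{\zeta-\lambda_i}\,\dfrac{(1-|\lambda_j|^2)^{1/2}}{\zeta-\lambda_j}\displaystyle\prod_{\mu=j+1}^{i-1}\frac{1-\bar\lambda_\mu\zeta}{\zeta-\lambda_\mu} & \text{if } i>j,\end{cases}$$ where the empty product is $1$. 3. The bound is attained by $M_B$ itself: the $|m|\times|m|$ matrix $T$ of $M_B$ in the Malmquist–Walsh basis satisfies $\|T\|_\infty\le1$, has minimal polynomial $m$ and spectrum $\sigma(A)$, and $\|(\zeta-T)^{-1}\|_\infty=\|(\zeta-M_B)^{-1}\|_\infty$ for every $\zeta\in\mathbb C\setminus\sigma(A)$. -/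

import Mathlib

open MeasureTheory
open scoped ENNReal ComplexConjugate Matrix.Norms.L2Operator

noncomputable section

namespace ModelSpace

instance instFactTwoPiPos : Fact (0 < 2 * Real.pi) := ⟨Real.two_pi_pos⟩

/-- The unit circle `∂𝔻`, parametrised by the angle modulo `2π`. -/
abbrev Circ : Type := AddCircle (2 * Real.pi)

/-- The point `z = exp (i t)` of the unit circle with angle `t`. -/
def pt (t : Circ) : ℂ := (AddCircle.toCircle t : ℂ)

/-- `L²(∂𝔻)` with respect to the normalised arc length `|dz| / 2π`. -/
abbrev L2 : Type := Lp ℂ 2 (AddCircle.haarAddCircle : Measure Circ)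

/-- The Hardy space `H₂`, identified with the space of boundary functions: the functions
in `L²(∂𝔻)` all of whose Fourier coefficients of negative index vanish. -/
def H2 : Submodule ℂ L2 where
  carrier := {f | ∀ n : ℤ, n < 0 → fourierCoeff (f : Circ → ℂ) n = 0}
  add_mem' := by
    intro f g hf hg n hn
    have hf' := hf n hn
    have hg' := hg n hn
    rw [← fourierBasis_repr] at hf' hg' ⊢
    rw [map_add, lp.coeFn_add, Pi.add_apply, hf', hg', add_zero]
  zero_mem' := by
    intro n _
    rw [← fourierBasis_repr, map_zero]
    rfl
  smul_mem' := by
    intro c f hf n hn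
    have hf' := hf n hn
    rw [← fourierBasis_repr] at hf' ⊢
    rw [map_smul, lp.coeFn_smul, Pi.smul_apply, hf', smul_zero]

theorem isClosed_H2 : IsClosed (H2 : Set L2) := by
  have h : (H2 : Set L2) = ⋂ n : ℤ, ⋂ _ : n < 0,
      {f : L2 | inner ℂ (fourierBasis (T := 2 * Real.pi) n) f = 0} := by
    ext f
    simp only [Set.mem_iInter, Set.mem_ofPred_eq, SetLike.mem_coe]
    refine forall_congr' fun n => forall_congr' fun _ => ?_
    rw [← HilbertBasis.repr_apply_apply, fourierBasis_repr]
  rw [h]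
  refine isClosed_iInter fun n => isClosed_iInter fun _ => ?_
  exact isClosed_eq (by fun_prop) continuous_const

/-- The finite Blaschke product `B(z) = ∏ᵢ (z - aᵢ) / (1 - āᵢ z)`. -/
def blaschke {d : ℕ} (a : Fin d → ℂ) (z : ℂ) : ℂ :=
  ∏ i, (z - a i) / (1 - conj (a i) * z)

/-- The subspace `B H₂` of `L²(∂𝔻)`, that is, the set of all products `B h` with `h ∈ H₂`. -/
def BH2 {d : ℕ} (a : Fin d → ℂ) : Submodule ℂ L2 where
  carrier := {g | ∃ h ∈ H2, (g : Circ → ℂ) =ᵐ[AddCircle.haarAddCircle]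
    fun t => blaschke a (pt t) * (h : Circ → ℂ) t}
  add_mem' := by
    rintro f g ⟨h, hh, hf⟩ ⟨k, hk, hg⟩
    refine ⟨h + k, H2.add_mem hh hk, ?_⟩
    filter_upwards [hf, hg, Lp.coeFn_add f g, Lp.coeFn_add h k] with t h1 h2 h3 h4
    rw [h3, h4, Pi.add_apply, Pi.add_apply, h1, h2, mul_add]
  zero_mem' := by
    refine ⟨0, H2.zero_mem, ?_⟩
    filter_upwards [Lp.coeFn_zero ℂ 2 (AddCircle.haarAddCircle : Measure Circ)] with t h1
    rw [h1, Pi.zero_apply, mul_zero]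
  smul_mem' := by
    rintro c f ⟨h, hh, hf⟩
    refine ⟨c • h, H2.smul_mem c hh, ?_⟩
    filter_upwards [hf, Lp.coeFn_smul c f, Lp.coeFn_smul c h] with t h1 h2 h3
    rw [h2, h3, Pi.smul_apply, Pi.smul_apply, h1, smul_eq_mul, smul_eq_mul]
    ring

/-- The model space `K_B = H₂ ∩ (B H₂)ᗮ`. -/
def K {d : ℕ} (a : Fin d → ℂ) : Submodule ℂ L2 := H2 ⊓ (BH2 a)ᗮ

instance instCompleteSpaceK {d : ℕ} (a : Fin d → ℂ) : CompleteSpace (K a) := by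
  have h : IsClosed (K a : Set L2) :=
    isClosed_H2.inter (Submodule.isClosed_orthogonal (BH2 a))
  exact h.completeSpace_coe

/-- Multiplication by the independent variable `z` on `L²(∂𝔻)`
(`fourierLp ∞ 1` is the function `z` as an element of `L^∞(∂𝔻)`). -/
def mulZ : L2 →L[ℂ] L2 :=
  (ContinuousLinearMap.mul ℂ ℂ).holderL AddCircle.haarAddCircle ∞ 2 2 (fourierLp ∞ 1)

theorem coeFn_mulZ (f : L2) : (mulZ f : Circ → ℂ) =ᵐ[AddCircle.haarAddCircle]
    fun t => pt t * (f : Circ → ℂ) t := by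
  have h1 := (ContinuousLinearMap.mul ℂ ℂ).coeFn_holder (r := 2)
    (fourierLp (T := 2 * Real.pi) ∞ 1) f
  filter_upwards [h1, coeFn_fourierLp (T := 2 * Real.pi) ∞ 1] with t h1 h2
  have h3 : (mulZ f : Circ → ℂ) t = ContinuousLinearMap.mul ℂ ℂ
      ((fourierLp (T := 2 * Real.pi) ∞ 1 : Circ → ℂ) t) ((f : Circ → ℂ) t) := h1
  rw [h3, h2, fourier_one]
  rfl

/-- The model operator (compressed shift) `M_B f = P_B (z f)` on `K_B`, where `P_B` is the
orthogonal projection onto `K_B`. -/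
def M {d : ℕ} (a : Fin d → ℂ) : K a →L[ℂ] K a :=
  (K a).orthogonalProjectionOnto ∘L mulZ ∘L (K a).subtypeL

/-- The Malmquist–Walsh functions
`e_k(z) = (1 - |a_k|²)^{1/2} / (1 - ā_k z) ∏_{i < k} (z - a_i) / (1 - ā_i z)`. -/
def malmquistWalsh {d : ℕ} (a : Fin d → ℂ) (k : Fin d) (z : ℂ) : ℂ :=
  (Real.sqrt (1 - ‖a k‖ ^ 2) : ℂ) / (1 - conj (a k) * z) *
    ∏ i ∈ Finset.Iio k, (z - a i) / (1 - conj (a i) * z)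

/-- `b` is the Malmquist–Walsh basis of `K_B`. -/
def IsMalmquistWalsh {d : ℕ} (a : Fin d → ℂ) (b : OrthonormalBasis (Fin d) ℂ (K a)) : Prop :=
  ∀ k, ((b k : L2) : Circ → ℂ) =ᵐ[AddCircle.haarAddCircle] fun t => malmquistWalsh a k (pt t)

/-- The matrix of an operator on `K_B` with respect to an orthonormal basis `b`; its
`(i, j)` entry is `⟨T b_j, b_i⟩`, the `i`-th coordinate of `T b_j`. -/
def matrixOf {d : ℕ} {a : Fin d → ℂ} (b : OrthonormalBasis (Fin d) ℂ (K a))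
    (T : K a →L[ℂ] K a) : Matrix (Fin d) (Fin d) ℂ :=
  LinearMap.toMatrix b.toBasis b.toBasis (T : K a →ₗ[ℂ] K a)

end ModelSpace

end

/-! The norm bound is a dilation argument. Since `σ(A)` lies in the disk, some power of `A` has norm
less than one, and the contraction `A*` is then part of a finite multiple of the backward shift on
`H2` (`IsShift.exists_dilation`): there are maps `Φ i : E → H2` with `S* Φ i = Φ i A*` that are
jointly isometric. As `m(A) = 0`, each adjoint `(Φ i)*` kills `B H2`, so the `Φ i` take values in
`K_B` and `(Φ i)* M_B = A (Φ i)*` (`exists_model_dilation`). Hence the adjoint of the resolvent of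
`A` is a restriction of copies of the adjoint of the resolvent of `M_B`, which gives the inequality.
The same intertwining, with `m(M_B) = 0`, identifies the minimal polynomials and hence the spectra.

The explicit matrix needs only that `S` is an isometry with one-dimensional defect space `ℂ e`.
Blaschke factors of `S` are then isometries commuting with `S`, and each splits off one
Malmquist–Walsh vector as the complement of its range. The claimed column of the resolvent satisfies
`(ζ - S) x = e_j - c B e` by a telescoping induction (`IsShift.sub_map_sum_resolventCoeff`), and
projecting onto `K_B` removes the last term. -/

noncomputable section

namespace ModelSpace

/-! ### Blaschke products and Malmquist–Walsh vectors of an abstract unilateral shift. -/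

section AbstractShift

variable {H : Type*} [NormedAddCommGroup H] [InnerProductSpace ℂ H]

/-- `S` is a unilateral shift of multiplicity one whose defect space is spanned by the unit
vector `e`: an isometry with `H = ℂ e ⊕ S H`. -/
structure IsShift (S : H →L[ℂ] H) (e : H) : Prop where
  inner_map : ∀ f g, inner ℂ (S f) (S g) = inner ℂ f g
  norm_vec : ‖e‖ = 1
  inner_vec : ∀ f, inner ℂ e (S f) = 0
  exists_eq : ∀ f, ∃ (c : ℂ) (g : H), f = c • e + S g

/-- The operator `(1 - l̄ S)⁻¹`. -/
def cauchy (S : H →L[ℂ] H) (l : ℂ) : H →L[ℂ] H := Ring.inverse (1 - conj l • S)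

/-- The Blaschke factor `(S - l) (1 - l̄ S)⁻¹` of a shift. -/
def factor (S : H →L[ℂ] H) (l : ℂ) : H →L[ℂ] H := (S - l • 1) * cauchy S l

/-- The normalised reproducing kernel `(1 - |l|²)^{1/2} (1 - l̄ S)⁻¹ e`. -/
def kernelVec (S : H →L[ℂ] H) (e : H) (l : ℂ) : H :=
  (Real.sqrt (1 - ‖l‖ ^ 2) : ℂ) • cauchy S l e

/-- The product of the first `k` Blaschke factors of a shift. -/
def blaschkeOp (S : H →L[ℂ] H) (a : ℕ → ℂ) : ℕ → (H →L[ℂ] H)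
  | 0 => 1
  | k + 1 => blaschkeOp S a k * factor S (a k)

/-- The abstract Malmquist–Walsh vectors of a shift. -/
def mwVec (S : H →L[ℂ] H) (e : H) (a : ℕ → ℂ) (k : ℕ) : H :=
  blaschkeOp S a k (kernelVec S e (a k))

variable {S : H →L[ℂ] H} {e : H} {l : ℂ} {a : ℕ → ℂ}

theorem sqrt_one_sub_sq_mul_self (hl : ‖l‖ < 1) :
    (Real.sqrt (1 - ‖l‖ ^ 2) : ℂ) * (Real.sqrt (1 - ‖l‖ ^ 2) : ℂ) = 1 - conj l * l := by
  rw [← Complex.ofReal_mul, Real.mul_self_sqrt (by nlinarith [norm_nonneg l]), mul_comm (conj l),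
    Complex.mul_conj, Complex.normSq_eq_norm_sq]
  push_cast
  rfl

theorem sqrt_one_sub_sq_ne_zero (hl : ‖l‖ < 1) : (Real.sqrt (1 - ‖l‖ ^ 2) : ℂ) ≠ 0 := by
  rw [Ne, Complex.ofReal_eq_zero, Real.sqrt_eq_zero (by nlinarith [norm_nonneg l])]
  nlinarith [norm_nonneg l]

namespace IsShift

theorem norm_map (hS : IsShift S e) (f : H) : ‖S f‖ = ‖f‖ := by
  rw [@norm_eq_sqrt_re_inner ℂ, @norm_eq_sqrt_re_inner ℂ, hS.inner_map]

theorem norm_le_one (hS : IsShift S e) : ‖S‖ ≤ 1 :=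
  S.opNorm_le_bound zero_le_one fun f => by rw [hS.norm_map, one_mul]

theorem commute_sub (S : H →L[ℂ] H) (l : ℂ) : Commute S (S - l • 1) :=
  (Commute.refl S).sub_right ((Commute.one_right S).smul_right _)

theorem exists_blaschkeOp_eq {j k : ℕ} (hjk : j ≤ k) (f : H) :
    ∃ g, blaschkeOp S a k f = blaschkeOp S a j g := by
  induction k, hjk using Nat.le_induction generalizing f with
  | base => exact ⟨f, rfl⟩
  | succ k _ ih => exact ih (factor S (a k) f)

variable [CompleteSpace H]

theorem isUnit_one_sub (hS : IsShift S e) (hl : ‖l‖ < 1) : IsUnit (1 - conj l • S) := by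
  refine isUnit_one_sub_of_norm_lt_one ?_
  rw [norm_smul, RCLike.norm_conj]
  nlinarith [norm_nonneg l, hS.norm_le_one, norm_nonneg S]

theorem one_sub_mul_cauchy (hS : IsShift S e) (hl : ‖l‖ < 1) :
    (1 - conj l • S) * cauchy S l = 1 :=
  Ring.mul_inverse_cancel _ (hS.isUnit_one_sub hl)

theorem cauchy_mul_one_sub (hS : IsShift S e) (hl : ‖l‖ < 1) :
    cauchy S l * (1 - conj l • S) = 1 :=
  Ring.inverse_mul_cancel _ (hS.isUnit_one_sub hl)

theorem cauchy_sub (hS : IsShift S e) (hl : ‖l‖ < 1) (f : H) :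
    cauchy S l f - conj l • S (cauchy S l f) = f :=
  congrArg (fun T : H →L[ℂ] H => T f) (hS.one_sub_mul_cauchy hl)

theorem commute_cauchy (hS : IsShift S e) (hl : ‖l‖ < 1) : Commute S (cauchy S l) := by
  obtain ⟨u, hu⟩ := hS.isUnit_one_sub hl
  have : Commute S (u : H →L[ℂ] H) := by
    rw [hu]
    exact (Commute.one_right S).sub_right ((Commute.refl S).smul_right _)
  rw [cauchy, ← hu, Ring.inverse_unit]
  exact this.units_inv_right

theorem commute_factor (hS : IsShift S e) (hl : ‖l‖ < 1) : Commute S (factor S l) :=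
  (commute_sub S l).mul_right (hS.commute_cauchy hl)

/-- With `g = (1 - l̄ S)⁻¹ f`, the two sides are the norms of `S g - l g` and `g - l̄ S g`, whose
squares expand identically because `S` is isometric. -/
theorem norm_factor (hS : IsShift S e) (hl : ‖l‖ < 1) (f : H) : ‖factor S l f‖ = ‖f‖ := by
  set g := cauchy S l f with hg
  have h1 : factor S l f = S g - l • g := rfl
  have h2 : f = g - conj l • S g := (hS.cauchy_sub hl f).symm
  rw [h1]
  conv_rhs => rw [h2]
  rw [← sq_eq_sq₀ (norm_nonneg _) (norm_nonneg _), @norm_sub_sq ℂ, @norm_sub_sq ℂ, norm_smul,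
    norm_smul, hS.norm_map, RCLike.norm_conj, inner_smul_right, inner_smul_right,
    ← inner_conj_symm g (S g), ← map_mul, RCLike.conj_re]

theorem inner_factor (hS : IsShift S e) (hl : ‖l‖ < 1) (f g : H) :
    inner ℂ (factor S l f) (factor S l g) = inner ℂ f g :=
  LinearIsometry.inner_map_map
    (⟨(factor S l : H →ₗ[ℂ] H), hS.norm_factor hl⟩ : H →ₗᵢ[ℂ] H) f g

/-- The vector `u = (1 - l̄ S)⁻¹ e` satisfies `u = e + l̄ S u`, an orthogonal sum, so `‖u‖² = 1 +
|l|² ‖u‖²`. -/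
theorem norm_kernelVec (hS : IsShift S e) (hl : ‖l‖ < 1) : ‖kernelVec S e l‖ = 1 := by
  set u := cauchy S l e with hu
  have h1 : u = e + conj l • S u := by
    rw [← sub_eq_iff_eq_add]
    exact hS.cauchy_sub hl e
  have h2 : ‖u‖ ^ 2 = 1 + ‖l‖ ^ 2 * ‖u‖ ^ 2 := by
    conv_lhs => rw [h1]
    rw [@norm_add_sq ℂ, inner_smul_right, hS.inner_vec, hS.norm_vec, norm_smul, RCLike.norm_conj,
      hS.norm_map]
    simp
    ring
  rw [kernelVec, norm_smul, ← sq_eq_sq₀ (by positivity) zero_le_one, mul_pow, Complex.norm_real,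
    Real.norm_eq_abs, sq_abs, Real.sq_sqrt (by nlinarith [norm_nonneg l])]
  linarith

theorem cauchy_apply_map (hS : IsShift S e) (hl : ‖l‖ < 1) (f : H) :
    cauchy S l (S f) = S (cauchy S l f) :=
  congrArg (fun T : H →L[ℂ] H => T f) (hS.commute_cauchy hl).eq.symm

/-- The kernel is an eigenvector of `S*` with eigenvalue `l̄`, hence orthogonal to the range of `S -
l`. -/
theorem inner_kernelVec_factor (hS : IsShift S e) (hl : ‖l‖ < 1) (f : H) :
    inner ℂ (kernelVec S e l) (factor S l f) = 0 := by
  set u := cauchy S l e with hu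
  set g := cauchy S l f with hg
  have h1 : u = e + conj l • S u := by
    rw [← sub_eq_iff_eq_add]
    exact hS.cauchy_sub hl e
  have h2 : factor S l f = S g - l • g := rfl
  rw [kernelVec, inner_smul_left, h2, inner_sub_right, inner_smul_right]
  have h3 : inner ℂ u (S g) = l * inner ℂ u g := by
    conv_lhs => rw [h1]
    rw [inner_add_left, hS.inner_vec, inner_smul_left, hS.inner_map, Complex.conj_conj, zero_add]
  rw [h3, sub_self, mul_zero]

theorem adjoint_map (hS : IsShift S e) (f : H) : ContinuousLinearMap.adjoint S (S f) = f :=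
  ext_inner_right ℂ fun g => by
    rw [ContinuousLinearMap.adjoint_inner_left, hS.inner_map]

theorem adjoint_vec (hS : IsShift S e) : ContinuousLinearMap.adjoint S e = 0 :=
  ext_inner_right ℂ fun g => by
    rw [ContinuousLinearMap.adjoint_inner_left, hS.inner_vec, inner_zero_left]

theorem exists_eq_adjoint (hS : IsShift S e) (f : H) :
    ∃ c : ℂ, f = c • e + S (ContinuousLinearMap.adjoint S f) := by
  obtain ⟨c, g, h⟩ := hS.exists_eq f
  refine ⟨c, ?_⟩
  have : ContinuousLinearMap.adjoint S f = g := by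
    rw [h, map_add, map_smul, hS.adjoint_vec, hS.adjoint_map, smul_zero, zero_add]
  rw [this, ← h]

/-- Applying `S*` to `f + l g = c e + S g` turns the problem into `(1 - l S*) g = S* f`, which a
Neumann series solves. -/
theorem exists_eq_sub (hS : IsShift S e) (hl : ‖l‖ < 1) (f : H) :
    ∃ (c : ℂ) (g : H), f = c • e + (S g - l • g) := by
  have hu : IsUnit (1 - l • ContinuousLinearMap.adjoint S) := by
    refine isUnit_one_sub_of_norm_lt_one ?_
    rw [norm_smul, LinearIsometryEquiv.norm_map]
    nlinarith [norm_nonneg l, hS.norm_le_one, norm_nonneg S]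
  set g := Ring.inverse (1 - l • ContinuousLinearMap.adjoint S)
    (ContinuousLinearMap.adjoint S f) with hg
  have h1 : g - l • ContinuousLinearMap.adjoint S g = ContinuousLinearMap.adjoint S f :=
    congrArg (fun T : H →L[ℂ] H => T (ContinuousLinearMap.adjoint S f))
      (Ring.mul_inverse_cancel _ hu)
  obtain ⟨c, hc⟩ := hS.exists_eq_adjoint (f + l • g)
  refine ⟨c, g, ?_⟩
  rw [map_add, map_smul, ← h1, sub_add_cancel] at hc
  rw [← add_sub_assoc, ← hc, add_sub_cancel_right]

/-- Decompose `(1 - l̄ S) f` along `e` and the range of `S - l`, then apply `(1 - l̄ S)⁻¹`. -/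
theorem exists_eq_factor (hS : IsShift S e) (hl : ‖l‖ < 1) (f : H) :
    ∃ (c : ℂ) (g : H), f = c • kernelVec S e l + factor S l g := by
  obtain ⟨c, g, h⟩ := hS.exists_eq_sub hl (f - conj l • S f)
  have h1 : cauchy S l (f - conj l • S f) = f :=
    congrArg (fun T : H →L[ℂ] H => T f) (hS.cauchy_mul_one_sub hl)
  refine ⟨c / (Real.sqrt (1 - ‖l‖ ^ 2) : ℂ), g, ?_⟩
  have h2 : factor S l g = S (cauchy S l g) - l • cauchy S l g := rfl
  rw [kernelVec, smul_smul, div_mul_cancel₀ _ (sqrt_one_sub_sq_ne_zero hl), h2,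
    ← hS.cauchy_apply_map hl, ← map_smul, ← map_smul, ← map_sub, ← map_add, ← h, h1]

/-! ### Products of Blaschke factors -/

theorem commute_blaschkeOp (hS : IsShift S e) (ha : ∀ i, ‖a i‖ < 1) (k : ℕ) :
    Commute S (blaschkeOp S a k) := by
  induction k with
  | zero => exact Commute.one_right S
  | succ k ih => exact ih.mul_right (hS.commute_factor (ha k))

theorem inner_blaschkeOp (hS : IsShift S e) (ha : ∀ i, ‖a i‖ < 1) (k : ℕ) (f g : H) :
    inner ℂ (blaschkeOp S a k f) (blaschkeOp S a k g) = inner ℂ f g := by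
  induction k generalizing f g with
  | zero => rfl
  | succ k ih =>
    change inner ℂ (blaschkeOp S a k (factor S (a k) f)) (blaschkeOp S a k (factor S (a k) g)) = _
    rw [ih, hS.inner_factor (ha k)]

theorem inner_mwVec_blaschkeOp (hS : IsShift S e) (ha : ∀ i, ‖a i‖ < 1) {j k : ℕ} (hjk : j < k)
    (f : H) : inner ℂ (mwVec S e a j) (blaschkeOp S a k f) = 0 := by
  obtain ⟨g, hg⟩ := exists_blaschkeOp_eq (S := S) (a := a) (Nat.succ_le_of_lt hjk) f
  rw [hg]
  change inner ℂ (blaschkeOp S a j _) (blaschkeOp S a j (factor S (a j) g)) = _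
  rw [hS.inner_blaschkeOp ha, hS.inner_kernelVec_factor (ha j)]

theorem orthonormal_mwVec (hS : IsShift S e) (ha : ∀ i, ‖a i‖ < 1) :
    Orthonormal ℂ (mwVec S e a) := by
  refine ⟨fun k => ?_, fun j k hjk => ?_⟩
  · rw [@norm_eq_sqrt_re_inner ℂ, mwVec, hS.inner_blaschkeOp ha, ← @norm_eq_sqrt_re_inner ℂ,
      hS.norm_kernelVec (ha k)]
  · rcases lt_or_gt_of_ne hjk with h | h
    · exact hS.inner_mwVec_blaschkeOp ha h _
    · exact inner_eq_zero_symm.1 (hS.inner_mwVec_blaschkeOp ha h _)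

theorem exists_eq_sum_mwVec (hS : IsShift S e) (ha : ∀ i, ‖a i‖ < 1) (N : ℕ) (f : H) :
    ∃ (c : ℕ → ℂ) (g : H), f = ∑ k ∈ Finset.range N, c k • mwVec S e a k + blaschkeOp S a N g := by
  induction N with
  | zero => exact ⟨0, f, by simp [blaschkeOp]⟩
  | succ N ih =>
    obtain ⟨c, g, h⟩ := ih
    obtain ⟨c', g', h'⟩ := hS.exists_eq_factor (ha N) g
    refine ⟨Function.update c N c', g', ?_⟩
    rw [Finset.sum_range_succ, Function.update_self, Finset.sum_congr rfl (g := fun k =>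
      c k • mwVec S e a k), add_assoc]
    · conv_lhs => rw [h, h']
      rw [map_add, map_smul]
      rfl
    · intro k hk
      rw [Function.update_of_ne (Finset.mem_range.1 hk).ne]

/-- Used for the contraction: an intertwiner into an operator killed by the polynomial must vanish
on the range of the Blaschke product. -/
theorem exists_blaschkeOp_eq_aeval_mul (hS : IsShift S e) (ha : ∀ i, ‖a i‖ < 1) (N : ℕ) :
    ∃ Q : H →L[ℂ] H, Commute S Q ∧ blaschkeOp S a N =
      Polynomial.aeval S (∏ i ∈ Finset.range N, (Polynomial.X - Polynomial.C (a i))) * Q := by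
  induction N with
  | zero => exact ⟨1, Commute.one_right S, by simp [blaschkeOp]⟩
  | succ N ih =>
    obtain ⟨Q, hQ, h⟩ := ih
    have hQ' : Commute Q (S - a N • 1) :=
      hQ.symm.sub_right ((Commute.one_right Q).smul_right _)
    refine ⟨Q * cauchy S (a N), hQ.mul_right (hS.commute_cauchy (ha N)), ?_⟩
    rw [blaschkeOp, h, Finset.prod_range_succ, map_mul, map_sub, Polynomial.aeval_X,
      Polynomial.aeval_C, Algebra.algebraMap_eq_smul_one, factor, mul_assoc, ← mul_assoc Q,
      hQ'.eq]
    simp only [mul_assoc]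

/-- Used for the model operator: the polynomial in `S` maps into the range of the Blaschke product,
which is orthogonal to the model space. -/
theorem exists_aeval_eq_blaschkeOp_mul (hS : IsShift S e) (ha : ∀ i, ‖a i‖ < 1) (N : ℕ) :
    ∃ Q : H →L[ℂ] H, Commute S Q ∧
      Polynomial.aeval S (∏ i ∈ Finset.range N, (Polynomial.X - Polynomial.C (a i))) =
        blaschkeOp S a N * Q := by
  induction N with
  | zero => exact ⟨1, Commute.one_right S, by simp [blaschkeOp]⟩
  | succ N ih =>
    obtain ⟨Q, hQ, h⟩ := ih
    have hQ' : Commute Q (S - a N • 1) :=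
      hQ.symm.sub_right ((Commute.one_right Q).smul_right _)
    have h1 : (S - a N • 1 : H →L[ℂ] H) = factor S (a N) * (1 - conj (a N) • S) := by
      rw [factor, mul_assoc, hS.cauchy_mul_one_sub (ha N), mul_one]
    refine ⟨(1 - conj (a N) • S) * Q,
      ((Commute.one_right S).sub_right ((Commute.refl S).smul_right _)).mul_right hQ, ?_⟩
    rw [Finset.prod_range_succ, map_mul, h, map_sub, Polynomial.aeval_X, Polynomial.aeval_C,
      Algebra.algebraMap_eq_smul_one, mul_assoc, hQ'.eq, h1, blaschkeOp]
    simp only [mul_assoc]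

theorem blaschkeOp_apply_map (hS : IsShift S e) (ha : ∀ i, ‖a i‖ < 1) (k : ℕ) (f : H) :
    blaschkeOp S a k (S f) = S (blaschkeOp S a k f) :=
  congrArg (fun T : H →L[ℂ] H => T f) (hS.commute_blaschkeOp ha k).eq.symm

/-- Together with `mwVec_sub_map`, this writes the consecutive remainders `B_{k+1} e` and `B_k e`
through the same two vectors, the `k`-th Malmquist–Walsh vector and its image under `S`. -/
theorem map_mwVec_sub (hS : IsShift S e) (ha : ∀ i, ‖a i‖ < 1) (k : ℕ) :
    S (mwVec S e a k) - a k • mwVec S e a k =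
      (Real.sqrt (1 - ‖a k‖ ^ 2) : ℂ) • blaschkeOp S a (k + 1) e := by
  rw [mwVec, ← hS.blaschkeOp_apply_map ha, ← map_smul, ← map_sub]
  change _ = (Real.sqrt (1 - ‖a k‖ ^ 2) : ℂ) • blaschkeOp S a k
    (S (cauchy S (a k) e) - a k • cauchy S (a k) e)
  rw [kernelVec, map_smul, smul_comm, ← smul_sub, map_smul]

theorem mwVec_sub_map (hS : IsShift S e) (ha : ∀ i, ‖a i‖ < 1) (k : ℕ) :
    mwVec S e a k - conj (a k) • S (mwVec S e a k) =
      (Real.sqrt (1 - ‖a k‖ ^ 2) : ℂ) • blaschkeOp S a k e := by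
  rw [mwVec, ← hS.blaschkeOp_apply_map ha, ← map_smul, ← map_sub, kernelVec, map_smul, smul_comm,
    ← smul_sub, map_smul, hS.cauchy_sub (ha k)]

/-- The coefficients of `(ζ - M)⁻¹ e_j` in the Malmquist–Walsh basis. -/
def _root_.ModelSpace.resolventCoeff (a : ℕ → ℂ) (ζ : ℂ) (i j : ℕ) : ℂ :=
  if i < j then 0
  else if i = j then 1 / (ζ - a i)
  else (Real.sqrt (1 - ‖a i‖ ^ 2) : ℂ) / (ζ - a i) *
    ((Real.sqrt (1 - ‖a j‖ ^ 2) : ℂ) / (ζ - a j)) *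
    ∏ μ ∈ Finset.Ioo j i, (1 - conj (a μ) * ζ) / (ζ - a μ)

/-- `(ζ - S)` maps the candidate for `(ζ - M)⁻¹ e_j` to `e_j` modulo the range of the Blaschke
product. -/
theorem sub_map_sum_resolventCoeff (hS : IsShift S e) (ha : ∀ i, ‖a i‖ < 1) {ζ : ℂ} {j N : ℕ}
    (hζ : ∀ i < N, ζ ≠ a i) (hN : j + 1 ≤ N) :
    ζ • ∑ i ∈ Finset.range N, resolventCoeff a ζ i j • mwVec S e a i -
        S (∑ i ∈ Finset.range N, resolventCoeff a ζ i j • mwVec S e a i) =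
      mwVec S e a j - ((Real.sqrt (1 - ‖a j‖ ^ 2) : ℂ) / (ζ - a j) *
        ∏ μ ∈ Finset.Ioo j N, (1 - conj (a μ) * ζ) / (ζ - a μ)) • blaschkeOp S a N e := by
  induction N, hN using Nat.le_induction with
  | base =>
    have h0 : ζ - a j ≠ 0 := sub_ne_zero.2 (hζ j j.lt_succ_self)
    have h1 : ∑ i ∈ Finset.range (j + 1), resolventCoeff a ζ i j • mwVec S e a i =
        (1 / (ζ - a j)) • mwVec S e a j := by
      rw [Finset.sum_range_succ, Finset.sum_eq_zero, zero_add, resolventCoeff,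
        if_neg (lt_irrefl j), if_pos rfl]
      intro i hi
      rw [resolventCoeff, if_pos (Finset.mem_range.1 hi), zero_smul]
    have h2 : Finset.Ioo j (j + 1) = ∅ := by
      ext
      simp
    have h3 : ((Real.sqrt (1 - ‖a j‖ ^ 2) : ℂ) / (ζ - a j)) • blaschkeOp S a (j + 1) e =
        (1 / (ζ - a j)) • (S (mwVec S e a j) - a j • mwVec S e a j) := by
      rw [hS.map_mwVec_sub ha, smul_smul, one_div_mul_eq_div]
    rw [h1, h2, Finset.prod_empty, mul_one, h3, map_smul]
    match_scalars <;> field_simp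
    ring
  | succ N hN ih =>
    have h0 : ζ - a N ≠ 0 := sub_ne_zero.2 (hζ N N.lt_succ_self)
    have hjN : j < N := hN
    have h1 : Finset.Ioo j (N + 1) = insert N (Finset.Ioo j N) := by
      ext
      simp
      omega
    have h2 : resolventCoeff a ζ N j = (Real.sqrt (1 - ‖a N‖ ^ 2) : ℂ) / (ζ - a N) *
        ((Real.sqrt (1 - ‖a j‖ ^ 2) : ℂ) / (ζ - a j) *
          ∏ μ ∈ Finset.Ioo j N, (1 - conj (a μ) * ζ) / (ζ - a μ)) := by
      rw [resolventCoeff, if_neg hjN.not_gt, if_neg hjN.ne', mul_assoc]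
    have hs := sqrt_one_sub_sq_mul_self (ha N)
    have hs0 := sqrt_one_sub_sq_ne_zero (ha N)
    have e1 := hS.map_mwVec_sub ha N
    have e2 := hS.mwVec_sub_map ha N
    rw [Finset.sum_range_succ, map_add, smul_add, add_sub_add_comm,
      ih fun i hi => hζ i (hi.trans N.lt_succ_self), h1, Finset.prod_insert (by simp), h2,
      map_smul]
    generalize (Real.sqrt (1 - ‖a j‖ ^ 2) : ℂ) / (ζ - a j) = x
    generalize ∏ μ ∈ Finset.Ioo j N, (1 - conj (a μ) * ζ) / (ζ - a μ) = y
    -- Both remainders are expressed through the `N`-th vector and its shift. The new coefficient is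
    -- the one for which `(ζ - S)` of the added term turns the multiple of `B_N e` into one of
    -- `B_{N+1} e`; comparing scalars uses `s² = 1 - |a N|²`.
    have e3 : blaschkeOp S a (N + 1) e = (Real.sqrt (1 - ‖a N‖ ^ 2) : ℂ)⁻¹ •
        (S (mwVec S e a N) - a N • mwVec S e a N) := by
      rw [e1, inv_smul_smul₀ hs0]
    have e4 : blaschkeOp S a N e = (Real.sqrt (1 - ‖a N‖ ^ 2) : ℂ)⁻¹ •
        (mwVec S e a N - conj (a N) • S (mwVec S e a N)) := by
      rw [e2, inv_smul_smul₀ hs0]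
    rw [e3, e4]
    generalize (Real.sqrt (1 - ‖a N‖ ^ 2) : ℂ) = s at *
    match_scalars
    · ring
    · field_simp
      linear_combination (ζ * x * y) * hs
    · field_simp
      linear_combination (-x * y) * hs

end IsShift

end AbstractShift

/-! ### Isometric dilation of contractions with a strictly contractive power. -/

section Dilation

/-- Gelfand's formula, the spectral radius being strictly less than one by compactness of the
spectrum. -/
theorem exists_norm_pow_lt_one {𝒜 : Type*} [NormedRing 𝒜] [NormedAlgebra ℂ 𝒜] [CompleteSpace 𝒜]
    (x : 𝒜) (hx : spectrum ℂ x ⊆ Metric.ball 0 1) : ∃ k : ℕ, ‖x ^ k‖ < 1 := by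
  rcases subsingleton_or_nontrivial 𝒜 with h | h
  · exact ⟨0, by rw [Subsingleton.elim (x ^ 0) 0, norm_zero]; exact one_pos⟩
  have h1 : spectralRadius ℂ x < 1 := by
    refine spectrum.spectralRadius_lt_of_forall_lt x (r := 1) fun z hz => ?_
    have := hx hz
    rw [mem_ball_zero_iff] at this
    exact_mod_cast this
  obtain ⟨k, hk, hk0⟩ :=
    (((spectrum.pow_nnnorm_pow_one_div_tendsto_nhds_spectralRadius x).eventually
      (gt_mem_nhds h1)).and (Filter.eventually_gt_atTop 0)).exists
  refine ⟨k, ?_⟩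
  have h2 : (0 : ℝ) < 1 / k := by positivity
  by_contra! h3
  refine hk.not_ge (ENNReal.one_le_rpow ?_ h2)
  exact_mod_cast h3

/-- Only a power of `L` is small, so the right inverse of `1 - L` is a finite geometric sum times
`(1 - L ^ k)⁻¹`. -/
theorem exists_sub_apply_eq {F : Type*} [NormedAddCommGroup F] [NormedSpace ℂ F] [CompleteSpace F]
    (L : F →L[ℂ] F) {k : ℕ} (hk : ‖L ^ k‖ < 1) (y : F) : ∃ x, x - L x = y := by
  have hu : IsUnit (1 - L ^ k) := isUnit_one_sub_of_norm_lt_one hk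
  have : (1 - L) * (∑ i ∈ Finset.range k, L ^ i) * Ring.inverse (1 - L ^ k) = 1 := by
    rw [mul_neg_geom_sum, Ring.mul_inverse_cancel _ hu]
  exact ⟨((∑ i ∈ Finset.range k, L ^ i) * Ring.inverse (1 - L ^ k)) y,
    congrArg (fun T : F →L[ℂ] F => T y) this⟩

variable {H : Type*} [NormedAddCommGroup H] [InnerProductSpace ℂ H]
variable {E : Type*} [NormedAddCommGroup E] [InnerProductSpace ℂ E] [CompleteSpace E]

/-- Positivity of `1 - C* C` gives a factorisation `D* D`; no further property of the defect
operator is needed. -/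
theorem exists_defect (C : E →L[ℂ] E) (hC : ‖C‖ ≤ 1) :
    ∃ D : E →L[ℂ] E, ∀ x, ‖D x‖ ^ 2 + ‖C x‖ ^ 2 = ‖x‖ ^ 2 := by
  have h2 : ∀ (T : E →L[ℂ] E) x, inner ℂ ((star T * T) x) x = ((‖T x‖ ^ 2 : ℝ) : ℂ) := by
    intro T x
    rw [Complex.ofReal_pow]
    exact (ContinuousLinearMap.adjoint_inner_left T x (T x)).trans (inner_self_eq_norm_sq_to_K _)
  have h1 : ∀ x, inner ℂ ((1 - star C * C) x) x = ((‖x‖ ^ 2 - ‖C x‖ ^ 2 : ℝ) : ℂ) := by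
    intro x
    rw [sub_apply, inner_sub_left, h2, Complex.ofReal_sub]
    refine congrArg (· - _) ((inner_self_eq_norm_sq_to_K (𝕜 := ℂ) x).trans ?_)
    rw [Complex.ofReal_pow]
    rfl
  have h : 0 ≤ 1 - star C * C := by
    rw [ContinuousLinearMap.nonneg_iff_isPositive, ContinuousLinearMap.isPositive_iff']
    refine ⟨(IsSelfAdjoint.one _).sub (IsSelfAdjoint.star_mul_self C), fun x => ?_⟩
    rw [h1, Complex.zero_le_real, sub_nonneg]
    have := C.le_of_opNorm_le hC x
    rw [one_mul] at this
    gcongr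
  obtain ⟨D, hD⟩ := CStarAlgebra.nonneg_iff_eq_star_mul_self.1 h
  refine ⟨D, fun x => ?_⟩
  have h3 := h1 x
  rw [hD, h2] at h3
  have := Complex.ofReal_injective h3
  linarith

/-- Formally `Φ = ∑ S^m Ψ C^m`, the fixed point of `Φ ↦ Ψ + S Φ C`. As `S` is isometric, the `k`-th
power of `Φ ↦ S Φ C` has norm at most `‖C ^ k‖`. -/
theorem IsShift.exists_intertwiner {S : H →L[ℂ] H} {e : H} (hS : IsShift S e) [CompleteSpace H]
    (C : E →L[ℂ] E) {k : ℕ} (hk : ‖C ^ k‖ < 1) (Ψ : E →L[ℂ] H) :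
    ∃ Φ : E →L[ℂ] H, ∀ x, Φ x = Ψ x + S (Φ (C x)) := by
  set L : (E →L[ℂ] H) →L[ℂ] (E →L[ℂ] H) :=
    ContinuousLinearMap.compL ℂ E H H S ∘L (ContinuousLinearMap.compL ℂ E E H).flip C with hL
  have h1 : ∀ Φ x, L Φ x = S (Φ (C x)) := fun _ _ => rfl
  have h2 : ∀ m Φ x, ‖(L ^ m) Φ x‖ = ‖Φ ((C ^ m) x)‖ := by
    intro m
    induction m with
    | zero => intro _ _; rfl
    | succ m ih =>
      intro Φ x
      rw [pow_succ, mul_apply_eq_comp, ih, h1, hS.norm_map, pow_succ']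
      rfl
  have h3 : ‖L ^ k‖ < 1 := by
    refine lt_of_le_of_lt
      (ContinuousLinearMap.opNorm_le_bound _ (norm_nonneg (C ^ k)) fun Φ => ?_) hk
    refine ContinuousLinearMap.opNorm_le_bound _ (by positivity) fun x => ?_
    rw [h2]
    calc ‖Φ ((C ^ k) x)‖ ≤ ‖Φ‖ * (‖C ^ k‖ * ‖x‖) := Φ.le_opNorm_of_le ((C ^ k).le_opNorm x)
      _ = ‖C ^ k‖ * ‖Φ‖ * ‖x‖ := by ring
  obtain ⟨Φ, h4⟩ := exists_sub_apply_eq L h3 Ψ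
  refine ⟨Φ, fun x => ?_⟩
  rw [← h1, ← add_apply, ← h4, sub_add_cancel]

/-- A contraction `C` with a power of norm less than one is a part of a multiple of the backward
shift: the maps `Φ i` are the components of an isometry which intertwines them. -/
theorem IsShift.exists_dilation {S : H →L[ℂ] H} {e : H} (hS : IsShift S e) [CompleteSpace H]
    {ι : Type*} [Fintype ι] (w : OrthonormalBasis ι ℂ E)
    (C : E →L[ℂ] E) (hC : ‖C‖ ≤ 1) {k : ℕ} (hk : ‖C ^ k‖ < 1) :
    ∃ Φ : ι → E →L[ℂ] H,
      (∀ i x, ContinuousLinearMap.adjoint S (Φ i x) = Φ i (C x)) ∧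
      ∀ x, ∑ i, ‖Φ i x‖ ^ 2 = ‖x‖ ^ 2 := by
  obtain ⟨D, hD⟩ := exists_defect C hC
  -- The `m`-th coefficient of `Φ i x` along `S^m e` is thus the `i`-th coordinate of `D C^m x`.
  have h0 := fun i => hS.exists_intertwiner C hk
    (((innerSL ℂ (w i)).comp D).smulRight e)
  choose Φ hΦ using h0
  have h1 : ∀ i x, Φ i x = (inner ℂ (w i) (D x) : ℂ) • e + S (Φ i (C x)) := hΦ
  refine ⟨Φ, fun i x => ?_, fun x => ?_⟩
  · rw [h1, map_add, map_smul, hS.adjoint_vec, hS.adjoint_map, smul_zero, zero_add]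
  have h2 : ∀ i x, ‖Φ i x‖ ^ 2 = ‖(inner ℂ (w i) (D x) : ℂ)‖ ^ 2 + ‖Φ i (C x)‖ ^ 2 := by
    intro i x
    conv_lhs => rw [h1]
    rw [@norm_add_sq ℂ, inner_smul_left, hS.inner_vec, norm_smul, hS.norm_vec, hS.norm_map]
    simp
  -- The failure of isometry is unchanged when `x` is replaced by `C x`, by the defect identity;
  -- along `C ^ (k * m) x → 0` it tends to zero, so it is zero.
  have h3 : ∀ x, ∑ i, ‖Φ i x‖ ^ 2 - ‖x‖ ^ 2 = ∑ i, ‖Φ i (C x)‖ ^ 2 - ‖C x‖ ^ 2 := by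
    intro x
    rw [Finset.sum_congr rfl fun i _ => h2 i x, Finset.sum_add_distrib, ← hD x,
      w.sum_sq_norm_inner_right]
    ring
  have h4 : ∀ m x, ∑ i, ‖Φ i x‖ ^ 2 - ‖x‖ ^ 2 =
      ∑ i, ‖Φ i ((C ^ m) x)‖ ^ 2 - ‖(C ^ m) x‖ ^ 2 := by
    intro m
    induction m with
    | zero => intro _; rfl
    | succ m ih =>
      intro x
      rw [h3, ih, pow_succ]
      rfl
  have h5 : Filter.Tendsto (fun m : ℕ => ((C ^ k) ^ m) x) Filter.atTop (nhds 0) := by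
    have := (ContinuousLinearMap.apply ℂ E x).continuous.tendsto 0 |>.comp
      (tendsto_pow_atTop_nhds_zero_of_norm_lt_one hk)
    rwa [map_zero] at this
  have h6 : Continuous fun y : E => ∑ i, ‖Φ i y‖ ^ 2 - ‖y‖ ^ 2 := by fun_prop
  have h7 := (h6.tendsto 0).comp h5
  have h8 : (fun y : E => ∑ i, ‖Φ i y‖ ^ 2 - ‖y‖ ^ 2) ∘ (fun m : ℕ => ((C ^ k) ^ m) x) =
      fun _ => ∑ i, ‖Φ i x‖ ^ 2 - ‖x‖ ^ 2 := by
    funext m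
    rw [h4 (k * m), pow_mul]
    rfl
  rw [h8] at h7
  have := tendsto_nhds_unique tendsto_const_nhds h7
  simp only [map_zero, norm_zero, ne_eq, OfNat.ofNat_ne_zero, not_false_eq_true, zero_pow,
    Finset.sum_const_zero, sub_zero] at this
  linarith

end Dilation

/-! ### The Hardy space as a concrete shift. -/

section Hardy

instance instCompleteSpaceH2 : CompleteSpace H2 := isClosed_H2.completeSpace_coe

theorem pt_eq_fourier (t : Circ) : pt t = fourier 1 t := fourier_one.symm

theorem norm_pt (t : Circ) : ‖pt t‖ = 1 := Circle.norm_coe _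

theorem fourierCoeff_mulZ (f : L2) (n : ℤ) :
    fourierCoeff (mulZ f : Circ → ℂ) n = fourierCoeff (f : Circ → ℂ) (n - 1) := by
  rw [fourierCoeff_congr_ae (coeFn_mulZ f)]
  refine integral_congr_ae (Filter.Eventually.of_forall fun t => ?_)
  simp only [smul_eq_mul]
  rw [← mul_assoc, pt_eq_fourier, ← fourier_add, neg_sub, neg_add_eq_sub]

theorem mulZ_mem_H2 {f : L2} (hf : f ∈ H2) : mulZ f ∈ H2 := fun n hn => by
  rw [fourierCoeff_mulZ]
  exact hf _ (by omega)

theorem inner_mulZ (f g : L2) : inner ℂ (mulZ f) (mulZ g) = inner ℂ f g := by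
  rw [L2.inner_def, L2.inner_def]
  refine integral_congr_ae ?_
  filter_upwards [coeFn_mulZ f, coeFn_mulZ g] with t hf hg
  have h : conj (pt t) * pt t = 1 := by
    rw [← Complex.normSq_eq_conj_mul_self, Complex.normSq_eq_norm_sq, norm_pt, one_pow,
      Complex.ofReal_one]
  rw [hf, hg, RCLike.inner_apply, RCLike.inner_apply, map_mul]
  linear_combination ((g : Circ → ℂ) t * conj ((f : Circ → ℂ) t)) * h

/-- Multiplication by `z̄` is the inverse on the circle. -/
theorem mulZ_surjective : Function.Surjective mulZ := by
  intro f
  refine ⟨(ContinuousLinearMap.mul ℂ ℂ).holderL AddCircle.haarAddCircle ∞ 2 2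
    (fourierLp ∞ (-1)) f, Lp.ext ?_⟩
  have h1 := (ContinuousLinearMap.mul ℂ ℂ).coeFn_holder (r := 2)
    (fourierLp (T := 2 * Real.pi) ∞ (-1)) f
  filter_upwards [h1, coeFn_fourierLp (T := 2 * Real.pi) ∞ (-1), coeFn_mulZ
    ((ContinuousLinearMap.mul ℂ ℂ).holderL AddCircle.haarAddCircle ∞ 2 2
      (fourierLp ∞ (-1)) f)] with t h1 h2 h3
  rw [h3]
  refine (congrArg (pt t * ·) h1).trans ?_
  rw [h2, pt_eq_fourier, ContinuousLinearMap.mul_apply', ← mul_assoc, ← fourier_add,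
    add_neg_cancel, fourier_zero, one_mul]

theorem fourierCoeff_eq_inner (f : L2) (n : ℤ) :
    fourierCoeff (f : Circ → ℂ) n = inner ℂ (fourierLp (T := 2 * Real.pi) 2 n) f := by
  rw [← fourierBasis_repr, HilbertBasis.repr_apply_apply, coe_fourierBasis]

/-- The shift operator on the Hardy space. -/
def shift : H2 →L[ℂ] H2 :=
  (mulZ ∘L H2.subtypeL).codRestrict H2 fun f => mulZ_mem_H2 f.2

/-- The constant function `1` in the Hardy space. -/
def vacuum : H2 := ⟨fourierLp 2 0, fun n hn => by
  rw [fourierCoeff_eq_inner, orthonormal_fourier.2 hn.ne]⟩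

theorem coe_shift (f : H2) : (shift f : L2) = mulZ f := rfl

theorem isShift_shift : IsShift shift vacuum where
  inner_map f g := inner_mulZ f g
  norm_vec := orthonormal_fourier.1 0
  inner_vec f := by
    change inner ℂ (fourierLp (T := 2 * Real.pi) 2 0) (mulZ f) = 0
    rw [← fourierCoeff_eq_inner, fourierCoeff_mulZ]
    exact f.2 _ (by norm_num)
  exists_eq f := by
    -- Remove the constant term and divide by `z`; the quotient stays in `H2` because its
    -- coefficient of index `-1` is the removed one.
    obtain ⟨g, hg⟩ := mulZ_surjective
      (f - fourierCoeff ((f : L2) : Circ → ℂ) 0 • (vacuum : L2))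
    have hgm : g ∈ H2 := by
      intro n hn
      have h1 : fourierCoeff (mulZ g : Circ → ℂ) (n + 1) = fourierCoeff (g : Circ → ℂ) n := by
        rw [fourierCoeff_mulZ, add_sub_cancel_right]
      rw [← h1, hg, fourierCoeff_eq_inner, inner_sub_right, inner_smul_right,
        ← fourierCoeff_eq_inner]
      have h2 := orthonormal_iff_ite.1 (orthonormal_fourier (T := 2 * Real.pi)) (n + 1) 0
      change _ - _ * inner ℂ _ (fourierLp (T := 2 * Real.pi) 2 0) = 0
      rw [h2]
      split_ifs with h
      · rw [h, mul_one, sub_self]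
      · rw [mul_zero, sub_zero]
        exact f.2 _ (by omega)
    refine ⟨fourierCoeff ((f : L2) : Circ → ℂ) 0, ⟨g, hgm⟩, Subtype.ext ?_⟩
    rw [Submodule.coe_add, coe_shift, Submodule.coe_smul, hg, add_sub_cancel]

theorem coeFn_vacuum : ((vacuum : L2) : Circ → ℂ) =ᵐ[AddCircle.haarAddCircle] fun _ => 1 := by
  filter_upwards [coeFn_fourierLp (T := 2 * Real.pi) 2 0] with t ht
  exact ht.trans fourier_zero

variable {l : ℂ} {a : ℕ → ℂ}

theorem one_sub_conj_mul_pt_ne_zero (hl : ‖l‖ < 1) (t : Circ) : 1 - conj l * pt t ≠ 0 := by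
  intro h
  have : ‖conj l * pt t‖ = 1 := by rw [← sub_eq_zero.1 h, norm_one]
  rw [norm_mul, norm_pt, RCLike.norm_conj, mul_one] at this
  exact hl.ne this

theorem coeFn_cauchy (hl : ‖l‖ < 1) (f : H2) :
    ((cauchy shift l f : L2) : Circ → ℂ) =ᵐ[AddCircle.haarAddCircle]
      fun t => ((f : L2) : Circ → ℂ) t / (1 - conj l * pt t) := by
  have h := congrArg (fun g : H2 => (g : L2)) (isShift_shift.cauchy_sub hl f)
  set g := cauchy shift l f
  replace h : (g : L2) - conj l • mulZ g = f := h
  filter_upwards [Lp.coeFn_sub (g : L2) (conj l • mulZ g), Lp.coeFn_smul (conj l) (mulZ g),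
    coeFn_mulZ g] with t h1 h2 h3
  rw [h, Pi.sub_apply, h2, Pi.smul_apply, h3, smul_eq_mul] at h1
  rw [eq_div_iff (one_sub_conj_mul_pt_ne_zero hl t), h1]
  ring

theorem coeFn_factor (hl : ‖l‖ < 1) (f : H2) :
    ((factor shift l f : L2) : Circ → ℂ) =ᵐ[AddCircle.haarAddCircle]
      fun t => (pt t - l) / (1 - conj l * pt t) * ((f : L2) : Circ → ℂ) t := by
  set g := cauchy shift l f with hg
  have h : (factor shift l f : L2) = mulZ g - l • (g : L2) := rfl
  rw [h]
  filter_upwards [Lp.coeFn_sub (mulZ g) (l • (g : L2)), Lp.coeFn_smul l (g : L2),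
    coeFn_mulZ g, coeFn_cauchy hl f] with t h1 h2 h3 h4
  rw [h1, Pi.sub_apply, h2, Pi.smul_apply, h3, smul_eq_mul, h4]
  ring

theorem coeFn_blaschkeOp (ha : ∀ i, ‖a i‖ < 1) (N : ℕ) (f : H2) :
    ((blaschkeOp shift a N f : L2) : Circ → ℂ) =ᵐ[AddCircle.haarAddCircle]
      fun t => (∏ i ∈ Finset.range N, (pt t - a i) / (1 - conj (a i) * pt t)) *
        ((f : L2) : Circ → ℂ) t := by
  induction N generalizing f with
  | zero => exact Filter.Eventually.of_forall fun t => by simp [blaschkeOp]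
  | succ N ih =>
    filter_upwards [ih (factor shift (a N) f), coeFn_factor (ha N) f] with t h1 h2
    refine h1.trans ?_
    rw [h2, Finset.prod_range_succ]
    ring

theorem coeFn_mwVec (ha : ∀ i, ‖a i‖ < 1) (k : ℕ) :
    (((mwVec shift vacuum a k : H2) : L2) : Circ → ℂ) =ᵐ[AddCircle.haarAddCircle]
      fun t => (Real.sqrt (1 - ‖a k‖ ^ 2) : ℂ) / (1 - conj (a k) * pt t) *
        ∏ i ∈ Finset.range k, (pt t - a i) / (1 - conj (a i) * pt t) := by
  filter_upwards [coeFn_blaschkeOp ha k (kernelVec shift vacuum (a k)),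
    Lp.coeFn_smul (Real.sqrt (1 - ‖a k‖ ^ 2) : ℂ) (cauchy shift (a k) vacuum : L2),
    coeFn_cauchy (ha k) vacuum, coeFn_vacuum] with t h1 h2 h3 h4
  refine h1.trans ?_
  rw [kernelVec, Submodule.coe_smul, h2, Pi.smul_apply, h3, h4, smul_eq_mul]
  ring

end Hardy

/-! ### The model space, its basis and the compressed shift. -/

section Model

variable {d : ℕ} {a : Fin d → ℂ}

/-- Extension of a finite sequence by zero. -/
def extendZero (a : Fin d → ℂ) (i : ℕ) : ℂ := if h : i < d then a ⟨i, h⟩ else 0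

@[simp]
theorem extendZero_val (a : Fin d → ℂ) (i : Fin d) : extendZero a i = a i := dif_pos i.2

/-- Padding with zeros keeps every index in the disk, so the results for sequences on `ℕ` apply. -/
theorem norm_extendZero_lt (ha : ∀ i, ‖a i‖ < 1) (i : ℕ) : ‖extendZero a i‖ < 1 := by
  rw [extendZero]
  split_ifs
  · exact ha _
  · rw [norm_zero]
    exact one_pos

theorem mem_BH2_iff (ha : ∀ i, ‖a i‖ < 1) {g : L2} :
    g ∈ BH2 a ↔ ∃ h : H2, g = blaschkeOp shift (extendZero a) d h := by
  have key : ∀ h : H2, ((blaschkeOp shift (extendZero a) d h : L2) : Circ → ℂ)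
      =ᵐ[AddCircle.haarAddCircle] fun t => blaschke a (pt t) * ((h : L2) : Circ → ℂ) t := by
    intro h
    filter_upwards [coeFn_blaschkeOp (norm_extendZero_lt ha) d h] with t ht
    rw [ht, Finset.prod_range, blaschke]
    simp only [extendZero_val]
  constructor
  · rintro ⟨h, hh, hg⟩
    exact ⟨⟨h, hh⟩, Lp.ext (hg.trans (key ⟨h, hh⟩).symm)⟩
  · rintro ⟨h, rfl⟩
    exact ⟨h, h.2, key h⟩

theorem blaschkeOp_mem_orthogonal_K (ha : ∀ i, ‖a i‖ < 1) (h : H2) :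
    (blaschkeOp shift (extendZero a) d h : L2) ∈ (K a)ᗮ :=
  Submodule.orthogonal_le (inf_le_right : K a ≤ (BH2 a)ᗮ)
    (Submodule.le_orthogonal_orthogonal _ ((mem_BH2_iff ha).2 ⟨h, rfl⟩))

theorem mem_K_iff (ha : ∀ i, ‖a i‖ < 1) (f : H2) :
    (f : L2) ∈ K a ↔ ∀ h : H2, inner ℂ (blaschkeOp shift (extendZero a) d h : L2) (f : L2) = 0 := by
  refine ⟨fun hf h =>
    Submodule.inner_left_of_mem_orthogonal hf (blaschkeOp_mem_orthogonal_K ha h),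
    fun hf => ⟨f.2, fun u hu => ?_⟩⟩
  obtain ⟨h, rfl⟩ := (mem_BH2_iff ha).1 hu
  exact hf h

theorem mwVec_mem_K (ha : ∀ i, ‖a i‖ < 1) {k : ℕ} (hk : k < d) :
    ((mwVec shift vacuum (extendZero a) k : H2) : L2) ∈ K a :=
  (mem_K_iff ha _).2 fun h => inner_eq_zero_symm.1
    (isShift_shift.inner_mwVec_blaschkeOp (norm_extendZero_lt ha) hk h)

/-- The projection of the Hardy space onto the model space. -/
def projK (a : Fin d → ℂ) : H2 →L[ℂ] K a := (K a).orthogonalProjectionOnto ∘L H2.subtypeL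

theorem projK_eq (f : H2) (hf : (f : L2) ∈ K a) : projK a f = ⟨f, hf⟩ :=
  (K a).orthogonalProjectionOnto_mem_subspace_eq_self ⟨f, hf⟩

theorem projK_blaschkeOp (ha : ∀ i, ‖a i‖ < 1) (h : H2) :
    projK a (blaschkeOp shift (extendZero a) d h) = 0 :=
  (K a).orthogonalProjectionOnto_apply_of_mem_orthogonal (blaschkeOp_mem_orthogonal_K ha h)

theorem M_apply (f : H2) (hf : (f : L2) ∈ K a) : M a ⟨f, hf⟩ = projK a (shift f) := rfl

/-- The `k`-th Malmquist–Walsh function as an element of the model space. -/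
def mwK (ha : ∀ i, ‖a i‖ < 1) (k : Fin d) : K a :=
  ⟨(mwVec shift vacuum (extendZero a) k : H2), mwVec_mem_K ha k.2⟩

theorem coe_sum_mwK (ha : ∀ i, ‖a i‖ < 1) (c : ℕ → ℂ) :
    ((∑ k : Fin d, c k • mwK ha k : K a) : L2) =
      (∑ k ∈ Finset.range d, c k • mwVec shift vacuum (extendZero a) k : H2) := by
  rw [Finset.sum_range, Submodule.coe_sum, Submodule.coe_sum]
  rfl

theorem exists_projK_eq (ha : ∀ i, ‖a i‖ < 1) (f : H2) :
    ∃ (c : ℕ → ℂ) (h : H2),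
      f = ∑ k ∈ Finset.range d, c k • mwVec shift vacuum (extendZero a) k +
        blaschkeOp shift (extendZero a) d h ∧
      projK a f = ∑ k : Fin d, c k • mwK ha k := by
  obtain ⟨c, h, hf⟩ := isShift_shift.exists_eq_sum_mwVec (norm_extendZero_lt ha) d f
  refine ⟨c, h, hf, ?_⟩
  rw [hf, map_add, projK_blaschkeOp ha, add_zero,
    projK_eq _ (coe_sum_mwK ha c ▸ Subtype.coe_prop _)]
  exact Subtype.ext (coe_sum_mwK ha c).symm

/-- `B H2` is invariant under the shift, so the compression is the induced action on the quotient: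
`P S = M P` holds on all of `H2`, not just on the model space. -/
theorem projK_shift (ha : ∀ i, ‖a i‖ < 1) (f : H2) : projK a (shift f) = M a (projK a f) := by
  obtain ⟨c, h, hf, hP⟩ := exists_projK_eq ha f
  have h1 : M a (projK a f) =
      projK a (shift (∑ k ∈ Finset.range d, c k • mwVec shift vacuum (extendZero a) k)) := by
    rw [hP, ← M_apply _ (coe_sum_mwK ha c ▸ Subtype.coe_prop _)]
    exact congrArg _ (Subtype.ext (coe_sum_mwK ha c))
  rw [h1]
  conv_lhs => rw [hf]
  rw [map_add, map_add, ← isShift_shift.blaschkeOp_apply_map (norm_extendZero_lt ha),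
    projK_blaschkeOp ha, add_zero]

theorem projK_surjective : Function.Surjective (projK a) := fun f =>
  ⟨⟨f, f.2.1⟩, projK_eq ⟨f, f.2.1⟩ f.2⟩

theorem orthonormal_mwK (ha : ∀ i, ‖a i‖ < 1) : Orthonormal ℂ (mwK ha) := by
  have h1 := (isShift_shift.orthonormal_mwVec (norm_extendZero_lt ha)).comp
    (fun k : Fin d => (k : ℕ)) Fin.val_injective
  exact ⟨fun k => h1.1 k, fun i j hij => h1.2 hij⟩

theorem top_le_span_mwK (ha : ∀ i, ‖a i‖ < 1) : ⊤ ≤ Submodule.span ℂ (Set.range (mwK ha)) := by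
  intro f _
  obtain ⟨f, rfl⟩ := projK_surjective f
  obtain ⟨c, h, -, hP⟩ := exists_projK_eq ha f
  rw [hP]
  exact Submodule.sum_mem _ fun k _ => Submodule.smul_mem _ _ (Submodule.subset_span ⟨k, rfl⟩)

/-- The Malmquist–Walsh orthonormal basis of the model space. -/
def mwBasis (ha : ∀ i, ‖a i‖ < 1) : OrthonormalBasis (Fin d) ℂ (K a) :=
  OrthonormalBasis.mk (orthonormal_mwK ha) (top_le_span_mwK ha)

theorem mwBasis_apply (ha : ∀ i, ‖a i‖ < 1) (k : Fin d) : mwBasis ha k = mwK ha k := by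
  rw [mwBasis, OrthonormalBasis.coe_mk]

theorem isMalmquistWalsh_mwBasis (ha : ∀ i, ‖a i‖ < 1) : IsMalmquistWalsh a (mwBasis ha) := by
  intro k
  rw [mwBasis_apply]
  filter_upwards [coeFn_mwVec (norm_extendZero_lt ha) k] with t ht
  refine ht.trans ?_
  rw [malmquistWalsh, extendZero_val, ← Nat.Iio_eq_range, ← Fin.map_valEmbedding_Iio,
    Finset.prod_map]
  simp

theorem sub_M_sum_mwBasis (ha : ∀ i, ‖a i‖ < 1) {ζ : ℂ} (hζ : ∀ i, ζ ≠ a i) (j : Fin d) :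
    ζ • (∑ i : Fin d, resolventCoeff (extendZero a) ζ i j • mwBasis ha i) -
      M a (∑ i : Fin d, resolventCoeff (extendZero a) ζ i j • mwBasis ha i) = mwBasis ha j := by
  set g := ∑ k ∈ Finset.range d, resolventCoeff (extendZero a) ζ k j •
    mwVec shift vacuum (extendZero a) k with hg
  have hgc := coe_sum_mwK ha fun k => resolventCoeff (extendZero a) ζ k j
  have hgm : (g : L2) ∈ K a := hgc ▸ Subtype.coe_prop _
  have h1 : ∑ i : Fin d, resolventCoeff (extendZero a) ζ i j • mwBasis ha i = projK a g := by
    rw [projK_eq g hgm]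
    simp only [mwBasis_apply]
    exact Subtype.ext hgc
  have h2 := isShift_shift.sub_map_sum_resolventCoeff (norm_extendZero_lt ha) (ζ := ζ) (j := j)
    (N := d) (fun i hi => by
      have := hζ ⟨i, hi⟩
      rwa [← extendZero_val a] at this) j.2
  rw [h1, ← projK_shift ha, ← map_smul, ← map_sub, h2, map_sub, map_smul, projK_blaschkeOp ha,
    smul_zero, sub_zero, projK_eq _ (mwVec_mem_K ha j.2), mwBasis_apply]
  rfl

theorem resolventCoeff_extendZero (a : Fin d → ℂ) (ζ : ℂ) (i j : Fin d) :
    resolventCoeff (extendZero a) ζ i j =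
      if i < j then 0
      else if i = j then 1 / (ζ - a i)
      else (Real.sqrt (1 - ‖a i‖ ^ 2) : ℂ) / (ζ - a i) *
        ((Real.sqrt (1 - ‖a j‖ ^ 2) : ℂ) / (ζ - a j)) *
        ∏ μ ∈ Finset.Ioo j i, (1 - conj (a μ) * ζ) / (ζ - a μ) := by
  rw [resolventCoeff, ← Fin.map_valEmbedding_Ioo, Finset.prod_map]
  simp [Fin.ext_iff]

theorem norm_M_le_one (a : Fin d → ℂ) : ‖M a‖ ≤ 1 := by
  refine ContinuousLinearMap.opNorm_le_bound _ zero_le_one fun f => ?_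
  have h1 : ‖mulZ (f : L2)‖ = ‖(f : L2)‖ := by
    rw [@norm_eq_sqrt_re_inner ℂ, @norm_eq_sqrt_re_inner ℂ, inner_mulZ]
  rw [one_mul]
  exact ((K a).norm_orthogonalProjectionOnto_apply_le (mulZ f)).trans h1.le

theorem comp_aeval {E F : Type*} [NormedAddCommGroup E] [NormedSpace ℂ E] [NormedAddCommGroup F]
    [NormedSpace ℂ F] {B : E →L[ℂ] F} {S : E →L[ℂ] E} {T : F →L[ℂ] F}
    (h : ∀ x, B (S x) = T (B x)) (p : Polynomial ℂ) (x : E) :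
    B (Polynomial.aeval S p x) = Polynomial.aeval T p (B x) := by
  induction p using Polynomial.induction_on' generalizing x with
  | add p q hp hq => rw [map_add, map_add, add_apply, add_apply, map_add, hp, hq]
  | monomial n c =>
    have hn : ∀ (n : ℕ) x, B ((S ^ n) x) = (T ^ n) (B x) := by
      intro n
      induction n with
      | zero => intro _; rfl
      | succ n ih =>
        intro x
        rw [pow_succ, pow_succ, mul_apply_eq_comp, mul_apply_eq_comp, ih, h]
    rw [Polynomial.aeval_monomial, Polynomial.aeval_monomial, Algebra.algebraMap_eq_smul_one,
      Algebra.algebraMap_eq_smul_one, smul_one_mul, smul_one_mul, smul_apply, smul_apply,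
      map_smul, hn]

theorem prod_range_extendZero (a : Fin d → ℂ) :
    ∏ i ∈ Finset.range d, (Polynomial.X - Polynomial.C (extendZero a i)) =
      ∏ i, (Polynomial.X - Polynomial.C (a i)) := by
  rw [Finset.prod_range]
  simp

theorem aeval_M_eq_zero (ha : ∀ i, ‖a i‖ < 1) :
    Polynomial.aeval (M a) (∏ i, (Polynomial.X - Polynomial.C (a i))) = 0 := by
  ext1 f
  obtain ⟨f, rfl⟩ := projK_surjective f
  obtain ⟨Q, -, hQ⟩ :=
    isShift_shift.exists_aeval_eq_blaschkeOp_mul (norm_extendZero_lt ha) d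
  rw [← comp_aeval (projK_shift ha), ← prod_range_extendZero, hQ, mul_apply_eq_comp,
    projK_blaschkeOp ha, zero_apply]

end Model

/-! ### Matrices of operators on the model space and the explicit resolvent. -/

section MatrixModel

variable {d : ℕ} {a : Fin d → ℂ}

/-- Invertibility is a separate hypothesis: `resolvent` is `Ring.inverse`, which is zero at
non-units, and a right inverse alone does not give a unit in a general ring. -/
theorem resolvent_eq_of_mul_eq_one {𝒜 : Type*} [Ring 𝒜] [Algebra ℂ 𝒜] {x y : 𝒜} {ζ : ℂ}
    (hu : IsUnit (algebraMap ℂ 𝒜 ζ - x)) (h : (algebraMap ℂ 𝒜 ζ - x) * y = 1) :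
    resolvent x ζ = y := by
  rw [resolvent, ← mul_one (Ring.inverse _), ← h, Ring.inverse_mul_cancel_left _ _ hu]

/-- The matrix of an operator on the model space as an isomorphism of algebras. -/
def matrixOfEquiv (b : OrthonormalBasis (Fin d) ℂ (K a)) :
    (K a →L[ℂ] K a) ≃ₐ[ℂ] Matrix (Fin d) (Fin d) ℂ :=
  haveI : FiniteDimensional ℂ (K a) := b.toBasis.finiteDimensional_of_finite
  (Module.End.toContinuousLinearMap (K a)).symm.trans (LinearMap.toMatrixAlgEquiv b.toBasis)

theorem matrixOfEquiv_apply (b : OrthonormalBasis (Fin d) ℂ (K a)) (T : K a →L[ℂ] K a) :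
    matrixOfEquiv b T = matrixOf b T := rfl

theorem norm_matrixOf (b : OrthonormalBasis (Fin d) ℂ (K a)) (T : K a →L[ℂ] K a) :
    ‖matrixOf b T‖ = ‖T‖ := by
  have h : ∀ x, Matrix.toEuclideanCLM (n := Fin d) (𝕜 := ℂ) (matrixOf b T) (b.repr x) =
      b.repr (T x) := by
    intro x
    refine WithLp.ofLp_injective 2 ?_
    rw [Matrix.ofLp_toEuclideanCLM]
    exact LinearMap.toMatrix_mulVec_repr b.toBasis b.toBasis (T : K a →ₗ[ℂ] K a) x
  rw [Matrix.cstar_norm_def]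
  refine le_antisymm ?_ ?_
  · refine ContinuousLinearMap.opNorm_le_bound _ T.opNorm_nonneg fun x => ?_
    obtain ⟨x, rfl⟩ := b.repr.surjective x
    rw [h, LinearIsometryEquiv.norm_map, LinearIsometryEquiv.norm_map]
    exact T.le_opNorm x
  · refine ContinuousLinearMap.opNorm_le_bound _ (norm_nonneg _) fun x => ?_
    rw [← b.repr.norm_map (T x), ← h, ← b.repr.norm_map x]
    exact ContinuousLinearMap.le_opNorm _ _

theorem sub_matrixOf_mul (ha : ∀ i, ‖a i‖ < 1) {ζ : ℂ} (hζ : ∀ i, ζ ≠ a i) :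
    (algebraMap ℂ _ ζ - matrixOf (mwBasis ha) (M a)) *
      Matrix.of (fun i j : Fin d => resolventCoeff (extendZero a) ζ i j) = 1 := by
  set b := mwBasis ha with hb
  set X : Matrix (Fin d) (Fin d) ℂ := Matrix.of
    (fun i j : Fin d => resolventCoeff (extendZero a) ζ i j) with hX
  obtain ⟨Y, hY⟩ := (matrixOfEquiv b).surjective X
  have h1 : ∀ j, Y (b j) = ∑ i : Fin d, resolventCoeff (extendZero a) ζ i j • b i := by
    intro j
    rw [← b.sum_repr (Y (b j))]
    refine Finset.sum_congr rfl fun i _ => ?_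
    congr 1
    have : matrixOf b Y i j = X i j := by rw [← hY, matrixOfEquiv_apply]
    rw [matrixOf, LinearMap.toMatrix_apply, hX, Matrix.of_apply] at this
    simpa using this
  have h2 : (algebraMap ℂ (K a →L[ℂ] K a) ζ - M a) * Y = 1 := by
    refine ContinuousLinearMap.coe_injective (b.toBasis.ext fun j => ?_)
    have := sub_M_sum_mwBasis ha hζ j
    rw [← h1] at this
    simpa [Algebra.algebraMap_eq_smul_one] using this
  have h3 := congrArg (matrixOfEquiv b) h2
  rw [map_mul, map_sub, AlgEquiv.commutes, hY, map_one] at h3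
  exact h3

/-- For square matrices the exhibited right inverse is enough; the matrix isomorphism carries this
back to operators. -/
theorem isUnit_sub_M (ha : ∀ i, ‖a i‖ < 1) {ζ : ℂ} (hζ : ∀ i, ζ ≠ a i) :
    IsUnit (algebraMap ℂ (K a →L[ℂ] K a) ζ - M a) := by
  have h : IsUnit (matrixOfEquiv (mwBasis ha) (algebraMap ℂ (K a →L[ℂ] K a) ζ - M a)) := by
    rw [map_sub, AlgEquiv.commutes]
    exact IsUnit.of_mul_eq_one _ (sub_matrixOf_mul ha hζ)
  exact (MulEquiv.isUnit_map (matrixOfEquiv (mwBasis ha))).1 h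

theorem resolvent_algEquiv {𝒜 ℬ : Type*} [Ring 𝒜] [Algebra ℂ 𝒜] [Ring ℬ] [Algebra ℂ ℬ]
    (φ : 𝒜 ≃ₐ[ℂ] ℬ) {x : 𝒜} {ζ : ℂ} (hu : IsUnit (algebraMap ℂ 𝒜 ζ - x)) :
    resolvent (φ x) ζ = φ (resolvent x ζ) := by
  have h : φ (algebraMap ℂ 𝒜 ζ - x) = algebraMap ℂ ℬ ζ - φ x := by
    rw [map_sub, AlgEquiv.commutes]
  refine resolvent_eq_of_mul_eq_one (h ▸ hu.map φ) ?_
  rw [← h, ← map_mul, resolvent, Ring.mul_inverse_cancel _ hu, map_one]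

theorem matrixOf_resolvent (ha : ∀ i, ‖a i‖ < 1) {ζ : ℂ} (hζ : ∀ i, ζ ≠ a i) :
    matrixOf (mwBasis ha) (resolvent (M a) ζ) =
      resolvent (matrixOf (mwBasis ha) (M a)) ζ :=
  (resolvent_algEquiv (matrixOfEquiv (mwBasis ha)) (isUnit_sub_M ha hζ)).symm

theorem resolvent_matrixOf (ha : ∀ i, ‖a i‖ < 1) {ζ : ℂ} (hζ : ∀ i, ζ ≠ a i) :
    resolvent (matrixOf (mwBasis ha) (M a)) ζ =
      Matrix.of (fun i j : Fin d => resolventCoeff (extendZero a) ζ i j) :=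
  resolvent_eq_of_mul_eq_one (IsUnit.of_mul_eq_one _ (sub_matrixOf_mul ha hζ))
    (sub_matrixOf_mul ha hζ)

end MatrixModel

/-! ### Comparison of a contraction with the model operator. -/

section Extremality

variable {d : ℕ} {a : Fin d → ℂ}
variable {E : Type*} [NormedAddCommGroup E] [InnerProductSpace ℂ E] [CompleteSpace E]

variable {G : Type*} [NormedAddCommGroup G] [InnerProductSpace ℂ G] [CompleteSpace G]

/-- The `Φ i` are jointly injective, so the ranges of their adjoints span a dense subspace; dually,
every `Φ i T*` vanishes, and therefore so does `T*`. -/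
theorem eq_zero_of_comp_adjoint {ι : Type*} [Fintype ι] {Φ : ι → E →L[ℂ] G}
    (hΦ : ∀ x, ∑ i, ‖Φ i x‖ ^ 2 = ‖x‖ ^ 2) {T : E →L[ℂ] E}
    (hT : ∀ i f, T (ContinuousLinearMap.adjoint (Φ i) f) = 0) : T = 0 := by
  have h : ∀ i x, Φ i (star T x) = 0 := by
    intro i x
    refine ext_inner_left ℂ fun f => ?_
    rw [← ContinuousLinearMap.adjoint_inner_left, inner_zero_right,
      ContinuousLinearMap.star_eq_adjoint,
      ContinuousLinearMap.adjoint_inner_right, hT, inner_zero_left]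
  rw [← star_eq_zero]
  ext1 x
  have := hΦ (star T x)
  simp only [h, norm_zero, ne_eq, OfNat.ofNat_ne_zero, not_false_eq_true, zero_pow,
    Finset.sum_const_zero] at this
  exact norm_eq_zero.1 (pow_eq_zero_iff two_ne_zero |>.1 this.symm)

/-- The intertwining passes to the resolvents. On adjoints it reads `Φ i R'* = R* Φ i`, so the joint
isometry bounds `‖R'* x‖` by `‖R‖ ‖x‖`. -/
theorem norm_resolvent_le_of_dilation {M : G →L[ℂ] G} {ι : Type*} [Fintype ι] {Φ : ι → E →L[ℂ] G}
    (hΦ : ∀ x, ∑ i, ‖Φ i x‖ ^ 2 = ‖x‖ ^ 2) {A : E →L[ℂ] E}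
    (hA : ∀ i f, ContinuousLinearMap.adjoint (Φ i) (M f) =
      A (ContinuousLinearMap.adjoint (Φ i) f)) {ζ : ℂ}
    (hM : IsUnit (algebraMap ℂ (G →L[ℂ] G) ζ - M))
    (hζ : IsUnit (algebraMap ℂ (E →L[ℂ] E) ζ - A)) :
    ‖resolvent A ζ‖ ≤ ‖resolvent (M) ζ‖ := by
  set R := resolvent (M) ζ with hR
  set R' := resolvent A ζ with hR'
  have h1 : ∀ f, ζ • R f - M (R f) = f := fun f => by
    have := congrArg (fun T : G →L[ℂ] G => T f) (Ring.mul_inverse_cancel _ hM)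
    simpa [Algebra.algebraMap_eq_smul_one, hR, resolvent] using this
  have h2 : ∀ x, R' (ζ • x - A x) = x := fun x => by
    have := congrArg (fun T : E →L[ℂ] E => T x) (Ring.inverse_mul_cancel _ hζ)
    simpa [Algebra.algebraMap_eq_smul_one, hR', resolvent] using this
  have h3 : ∀ i f, R' (ContinuousLinearMap.adjoint (Φ i) f) =
      ContinuousLinearMap.adjoint (Φ i) (R f) := by
    intro i f
    conv_lhs => rw [← h1 f]
    rw [map_sub, map_smul, hA, h2]
  have h4 : ∀ i x, Φ i (star R' x) = star R (Φ i x) := by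
    intro i x
    refine ext_inner_left ℂ fun f => ?_
    rw [← ContinuousLinearMap.adjoint_inner_left, ContinuousLinearMap.star_eq_adjoint,
      ContinuousLinearMap.adjoint_inner_right, h3, ContinuousLinearMap.adjoint_inner_left,
      ContinuousLinearMap.star_eq_adjoint, ContinuousLinearMap.adjoint_inner_right]
  rw [← norm_star R', ← norm_star R]
  refine ContinuousLinearMap.opNorm_le_bound _ (norm_nonneg _) fun x => ?_
  rw [← sq_le_sq₀ (norm_nonneg _) (by positivity), mul_pow, ← hΦ, ← hΦ x, Finset.mul_sum]
  refine Finset.sum_le_sum fun i _ => ?_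
  rw [h4, ← mul_pow]
  gcongr
  exact ContinuousLinearMap.le_opNorm _ _

/-- A contraction annihilated by the polynomial with zeros `a i` is a compression of a multiple of
`M a`: the maps `Φ i` are the components of an isometry which intertwines the adjoints. -/
theorem exists_model_dilation (ha : ∀ i, ‖a i‖ < 1) {ι : Type*} [Fintype ι]
    (w : OrthonormalBasis ι ℂ E) (A : E →L[ℂ] E) (hA : ‖A‖ ≤ 1) {k : ℕ} (hk : ‖A ^ k‖ < 1)
    (hm : Polynomial.aeval A (∏ i, (Polynomial.X - Polynomial.C (a i))) = 0) :
    ∃ Φ : ι → E →L[ℂ] K a,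
      (∀ i f, ContinuousLinearMap.adjoint (Φ i) (M a f) =
        A (ContinuousLinearMap.adjoint (Φ i) f)) ∧
      ∀ x, ∑ i, ‖Φ i x‖ ^ 2 = ‖x‖ ^ 2 := by
  have hk' : ‖(star A) ^ k‖ < 1 := by rwa [← star_pow, norm_star]
  obtain ⟨Φ, h1, h2⟩ := isShift_shift.exists_dilation w (star A) (by rwa [norm_star]) hk'
  have h3 : ∀ i f, ContinuousLinearMap.adjoint (Φ i) (shift f) =
      A (ContinuousLinearMap.adjoint (Φ i) f) := by
    intro i f
    refine ext_inner_right ℂ fun x => ?_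
    rw [ContinuousLinearMap.adjoint_inner_left, ← ContinuousLinearMap.adjoint_inner_right, h1,
      ← ContinuousLinearMap.adjoint_inner_left]
    exact ContinuousLinearMap.adjoint_inner_right A _ x
  -- This is where annihilation by the polynomial enters: it forces the values of `Φ i` to be
  -- orthogonal to `B H2`.
  have h4 : ∀ i h, ContinuousLinearMap.adjoint (Φ i) (blaschkeOp shift (extendZero a) d h) = 0 := by
    intro i h
    obtain ⟨Q, -, hQ⟩ := isShift_shift.exists_blaschkeOp_eq_aeval_mul (norm_extendZero_lt ha) d
    rw [hQ, mul_apply_eq_comp, comp_aeval (h3 i), prod_range_extendZero, hm, zero_apply]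
  have h5 : ∀ i x, (Φ i x : L2) ∈ K a := by
    intro i x
    refine (mem_K_iff ha _).2 fun h => ?_
    change inner ℂ (blaschkeOp shift (extendZero a) d h) (Φ i x) = 0
    rw [← ContinuousLinearMap.adjoint_inner_left, h4, inner_zero_left]
  refine ⟨fun i => (H2.subtypeL ∘L Φ i).codRestrict (K a) (h5 i), fun i f => ?_, h2⟩
  -- The adjoint of `Φ i` factors through the projection, so the relation for the shift descends to
  -- `M a`.
  have h6 : ∀ g : H2, ContinuousLinearMap.adjoint
      ((H2.subtypeL ∘L Φ i).codRestrict (K a) (h5 i)) (projK a g) =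
        ContinuousLinearMap.adjoint (Φ i) g := by
    intro g
    refine ext_inner_right ℂ fun x => ?_
    rw [ContinuousLinearMap.adjoint_inner_left, ContinuousLinearMap.adjoint_inner_left]
    exact (K a).inner_orthogonalProjectionOnto_eq_of_mem_right _ _
  obtain ⟨f, rfl⟩ := projK_surjective f
  rw [← projK_shift ha, h6, h6, h3]

/-- Two divisibilities: the polynomial kills `M a`, and anything killing `M a` kills `A` through the
intertwining and the joint injectivity of the `Φ i`. -/
theorem minpoly_M_eq (ha : ∀ i, ‖a i‖ < 1) {ι : Type*} [Fintype ι] {Φ : ι → E →L[ℂ] K a}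
    (hΦ : ∀ x, ∑ i, ‖Φ i x‖ ^ 2 = ‖x‖ ^ 2) {A : E →L[ℂ] E}
    (hA : ∀ i f, ContinuousLinearMap.adjoint (Φ i) (M a f) =
      A (ContinuousLinearMap.adjoint (Φ i) f))
    (hm : minpoly ℂ A = ∏ i, (Polynomial.X - Polynomial.C (a i))) :
    minpoly ℂ (M a) = minpoly ℂ A := by
  have hmon : (∏ i, (Polynomial.X - Polynomial.C (a i))).Monic :=
    Polynomial.monic_prod_X_sub_C _ _
  have h1 : minpoly ℂ (M a) ∣ minpoly ℂ A := by
    rw [hm]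
    exact minpoly.dvd ℂ _ (aeval_M_eq_zero ha)
  have hint : IsIntegral ℂ (M a) := ⟨_, hmon, aeval_M_eq_zero ha⟩
  have h2 : minpoly ℂ A ∣ minpoly ℂ (M a) := by
    refine minpoly.dvd ℂ _ (eq_zero_of_comp_adjoint hΦ fun i f => ?_)
    rw [← comp_aeval (hA i), minpoly.aeval, zero_apply, map_zero]
  exact Polynomial.eq_of_monic_of_associated (minpoly.monic hint) (hm ▸ hmon)
    (associated_of_dvd_dvd h1 h2)

theorem mem_spectrum_iff_isRoot_minpoly {n : ℕ} (A : Matrix (Fin n) (Fin n) ℂ) (ζ : ℂ) :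
    ζ ∈ spectrum ℂ A ↔ (minpoly ℂ A).IsRoot ζ := by
  rw [← AlgEquiv.spectrum_eq (Matrix.toLinAlgEquiv' (R := ℂ) (n := Fin n)),
    ← minpoly.algEquiv_eq (Matrix.toLinAlgEquiv' (R := ℂ) (n := Fin n)),
    ← Module.End.hasEigenvalue_iff_mem_spectrum, Module.End.hasEigenvalue_iff_isRoot]

end Extremality

end ModelSpace

end

/-! ### The resolvent bound, the explicit matrix and extremality. -/

theorem theorem2 {n d : ℕ} (A : Matrix (Fin n) (Fin n) ℂ) (a : Fin d → ℂ)
    (hA : ‖A‖ ≤ 1)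
    (hm : minpoly ℂ A = ∏ i, (Polynomial.X - Polynomial.C (a i)))
    (hσ : spectrum ℂ A ⊆ Metric.ball 0 1) :
    (∀ ζ : ℂ, ζ ∉ spectrum ℂ A →
      IsUnit (algebraMap ℂ (ModelSpace.K a →L[ℂ] ModelSpace.K a) ζ - ModelSpace.M a) ∧
      ‖resolvent A ζ‖ ≤ ‖resolvent (ModelSpace.M a) ζ‖) ∧
    ∃ b : OrthonormalBasis (Fin d) ℂ (ModelSpace.K a), ModelSpace.IsMalmquistWalsh a b ∧
      (∀ ζ : ℂ, ζ ∉ spectrum ℂ A → ∀ i j : Fin d,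
        ModelSpace.matrixOf b (resolvent (ModelSpace.M a) ζ) i j =
          if i < j then 0
          else if i = j then 1 / (ζ - a i)
          else (Real.sqrt (1 - ‖a i‖ ^ 2) : ℂ) / (ζ - a i) *
            ((Real.sqrt (1 - ‖a j‖ ^ 2) : ℂ) / (ζ - a j)) *
            ∏ μ ∈ Finset.Ioo j i, (1 - conj (a μ) * ζ) / (ζ - a μ)) ∧
      (‖ModelSpace.matrixOf b (ModelSpace.M a)‖ ≤ 1 ∧
        minpoly ℂ (ModelSpace.matrixOf b (ModelSpace.M a)) = minpoly ℂ A ∧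
        spectrum ℂ (ModelSpace.matrixOf b (ModelSpace.M a)) = spectrum ℂ A ∧
        ∀ ζ : ℂ, ζ ∉ spectrum ℂ A →
          ‖resolvent (ModelSpace.matrixOf b (ModelSpace.M a)) ζ‖ =
            ‖resolvent (ModelSpace.M a) ζ‖) := by
  have hspec : ∀ ζ, ζ ∈ spectrum ℂ A ↔ ∃ i, ζ = a i := by
    intro ζ
    rw [ModelSpace.mem_spectrum_iff_isRoot_minpoly, hm, Polynomial.IsRoot, Polynomial.eval_prod,
      Finset.prod_eq_zero_iff]
    simp [sub_eq_zero]
  have ha : ∀ i, ‖a i‖ < 1 := fun i =>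
    mem_ball_zero_iff.1 (hσ ((hspec _).2 ⟨i, rfl⟩))
  have hne : ∀ ζ, ζ ∉ spectrum ℂ A → ∀ i, ζ ≠ a i := fun ζ hζ i h =>
    hζ ((hspec ζ).2 ⟨i, h⟩)
  -- The dilation needs operators on a Hilbert space; the `L2Operator` matrix norm is by definition
  -- the operator norm of this image.
  let φ : Matrix (Fin n) (Fin n) ℂ ≃ₐ[ℂ]
      (EuclideanSpace ℂ (Fin n) →L[ℂ] EuclideanSpace ℂ (Fin n)) :=
    (Matrix.toEuclideanCLM (n := Fin n) (𝕜 := ℂ)).toAlgEquiv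
  have hφ : ∀ B, ‖φ B‖ = ‖B‖ := fun _ => rfl
  have hmφ : minpoly ℂ (φ A) = minpoly ℂ A := minpoly.algEquiv_eq φ A
  obtain ⟨k, hk⟩ := ModelSpace.exists_norm_pow_lt_one (φ A) (by rwa [AlgEquiv.spectrum_eq])
  obtain ⟨Φ, h1, h2⟩ := ModelSpace.exists_model_dilation ha (EuclideanSpace.basisFun (Fin n) ℂ)
    (φ A) hA hk (by rw [← hm, ← hmφ, minpoly.aeval])
  have hmin : minpoly ℂ (ModelSpace.matrixOf (ModelSpace.mwBasis ha) (ModelSpace.M a)) =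
      minpoly ℂ A :=
    (minpoly.algEquiv_eq (ModelSpace.matrixOfEquiv (ModelSpace.mwBasis ha)) (ModelSpace.M a)).trans
      ((ModelSpace.minpoly_M_eq ha h2 h1 (hmφ.trans hm)).trans hmφ)
  refine ⟨fun ζ hζ => ⟨ModelSpace.isUnit_sub_M ha (hne ζ hζ), ?_⟩, ModelSpace.mwBasis ha,
    ModelSpace.isMalmquistWalsh_mwBasis ha, fun ζ hζ i j => ?_, ?_, hmin, ?_, fun ζ hζ => ?_⟩
  · have hu : IsUnit (algebraMap ℂ _ ζ - A) := spectrum.notMem_iff.1 hζ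
    have hu' : IsUnit (algebraMap ℂ _ ζ - φ A) := by
      rw [← AlgEquiv.commutes φ, ← map_sub]
      exact hu.map φ
    rw [← hφ, ← ModelSpace.resolvent_algEquiv φ hu]
    exact ModelSpace.norm_resolvent_le_of_dilation h2 h1 (ModelSpace.isUnit_sub_M ha (hne ζ hζ)) hu'
  · rw [ModelSpace.matrixOf_resolvent ha (hne ζ hζ), ModelSpace.resolvent_matrixOf ha (hne ζ hζ),
      Matrix.of_apply, ModelSpace.resolventCoeff_extendZero]
  · rw [ModelSpace.norm_matrixOf]
    exact ModelSpace.norm_M_le_one a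
  · ext ζ
    rw [ModelSpace.mem_spectrum_iff_isRoot_minpoly, ModelSpace.mem_spectrum_iff_isRoot_minpoly, hmin]
  · rw [← ModelSpace.matrixOf_resolvent ha (hne ζ hζ), ModelSpace.norm_matrixOf]
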